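/- Let $S=\mathbb{C}[x,y,z]$ and let $C: f=0$ be a reduced curve of degree $d\ge 3$ in $\mathbb{P}^2$, with Jacobian ideal $J_f=(f_x,f_y,f_z)$, Milnor algebra $M(f)=S/J_f$ and module of Jacobian syzygies $D_0(f)=\{(a,b,c)\in S^3 : af_x+bf_y+cf_z=0\}$. The curve $C$ is said to be of type $(d,r,m)$ if $D_0(f)$ is minimally generated by $m$ homogeneous syzygies, all of the same degree $r$. The total Tjurina number $\tau(C)$ is the degree of $J_f$, i.e. the constant value of $\dim_{\mathbb{C}} M(f)_k$ for $k\gg 0$. Let $C$ be a curve of type $(d,r,m)$ with $m>3$ and $\Delta m := 2r-d+3-m = 1$. Then $M(f)$ has a minimal graded free resolution of the form $$0\to \bigoplus_{i=1}^{m-2} S(-e_i)\to \bigoplus_{j=1}^{m} S(1-d-d_j)\to S^3(1-d)\to S,$$ where $e_1\le\dots\le e_{m-2}$ and $d_1=\dots=d_m=r$, and where the last map is $(a,b,c)\mapsto af_x+bf_y+cf_z$. In every such minimal resolution, the integers $\epsilon_j$ defined by $e_j=d+d_{j+2}-1+\epsilon_j$ for $1\le j\le m-2$ satisfy $\epsilon_{m-2}=2$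 and $\epsilon_j=1$ for $1\le j\le m-3$. Moreover, $$\tau(C)=\frac{d(d-1)}{2}-1+r(d-r-2).$$ -/

import Mathlib

namespace PlaneCurve

/-- The polynomial ring `S = ℂ[x, y, z]`. -/
abbrev S : Type := MvPolynomial (Fin 3) ℂ

/-- The Jacobian ideal `J_f = (f_x, f_y, f_z)`. -/
noncomputable def jacobianIdeal (f : S) : Ideal S :=
  Ideal.span (Set.range fun i : Fin 3 => MvPolynomial.pderiv i f)

/-- The Milnor (Jacobian) algebra `M(f) = S / J_f`. -/
abbrev MilnorAlgebra (f : S) : Type := S ⧸ jacobianIdeal f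

/-- The homogeneous component `M(f)_k`: the classes of the forms of degree `k`. -/
noncomputable def milnorComponent (f : S) (k : ℕ) : Submodule ℂ (MilnorAlgebra f) :=
  (MvPolynomial.homogeneousSubmodule (Fin 3) ℂ k).map
    (Ideal.Quotient.mkₐ ℂ (jacobianIdeal f)).toLinearMap

/-- `τ` is the total Tjurina number of the reduced curve `f = 0`, that is, the degree of its
Jacobian ideal: the Hilbert polynomial of `S / J_f` is the constant `τ`. -/
def IsTotalTjurinaNumber (f : S) (τ : ℕ) : Prop :=
  ∀ᶠ k : ℕ in Filter.atTop, Module.finrank ℂ (milnorComponent f k) = τ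

/-- The total Tjurina number is unique. -/
theorem IsTotalTjurinaNumber.unique {f : S} {τ τ' : ℕ}
    (h : IsTotalTjurinaNumber f τ) (h' : IsTotalTjurinaNumber f τ') : τ = τ' := by
  obtain ⟨k, hk, hk'⟩ := (Filter.Eventually.and h h').exists
  exact hk.symm.trans hk'

/-- The map `S³ → S`, `(a, b, c) ↦ a f_x + b f_y + c f_z`. -/
noncomputable def gradientMap (f : S) : (Fin 3 → S) →ₗ[S] S :=
  Fintype.linearCombination S fun i : Fin 3 => MvPolynomial.pderiv i f

theorem gradientMap_apply (f : S) (ρ : Fin 3 → S) :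
    gradientMap f ρ = ρ 0 * MvPolynomial.pderiv 0 f + ρ 1 * MvPolynomial.pderiv 1 f
      + ρ 2 * MvPolynomial.pderiv 2 f := by
  simp [gradientMap, Fintype.linearCombination_apply, Fin.sum_univ_three]

/-- The cokernel of `gradientMap f` is `M(f)`. -/
theorem range_gradientMap (f : S) : LinearMap.range (gradientMap f) = jacobianIdeal f := by
  simp [gradientMap, jacobianIdeal, Fintype.range_linearCombination, Ideal.span]

/-- The module `D₀(f)` of Jacobian syzygies of `f`. -/
noncomputable def jacobianSyzygies (f : S) : Submodule S (Fin 3 → S) :=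
  LinearMap.ker (gradientMap f)

/-- `ρ 0, …, ρ (m - 1)` is a minimal set of homogeneous generators of `D₀(f)`, and `ρ j` is of
degree `deg j`. -/
structure IsMinimalGenerators (f : S) {m : ℕ} (deg : Fin m → ℕ) (ρ : Fin m → Fin 3 → S) :
    Prop where
  homogeneous : ∀ j i, (ρ j i).IsHomogeneous (deg j)
  span_eq : Submodule.span S (Set.range ρ) = jacobianSyzygies f
  minimal : ∀ j, ρ j ∉ Submodule.span S (ρ '' {j}ᶜ)

/-- `f = 0` is a curve of type `(d, r, m)`: a reduced curve of degree `d ≥ 3` in `ℙ²` such that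
`D₀(f)` is minimally generated by `m` homogeneous syzygies, all of the same degree `r`. -/
structure IsCurveOfType (f : S) (d r m : ℕ) : Prop where
  three_le : 3 ≤ d
  homogeneous : f.IsHomogeneous d
  reduced : Squarefree f
  generators : ∃ ρ : Fin m → Fin 3 → S, IsMinimalGenerators f (fun _ => r) ρ

/-- `v` is a homogeneous element of degree `n` of the graded free module `⊕ᵢ S(-a i)`. -/
def IsHomogeneousVec {ι : Type} (a : ι → ℕ) (n : ℕ) (v : ι → S) : Prop :=
  ∀ i, (a i ≤ n ∧ (v i).IsHomogeneous (n - a i)) ∨ v i = 0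

/-- `φ : ⊕ⱼ S(-b j) → ⊕ᵢ S(-a i)` is homogeneous of degree zero. -/
def IsGradedMap {ι κ : Type} [DecidableEq κ] (b : κ → ℕ) (a : ι → ℕ)
    (φ : (κ → S) →ₗ[S] (ι → S)) : Prop :=
  ∀ j, IsHomogeneousVec a (b j) (φ (Pi.single j 1))

/-- All entries of the matrix of `φ` lie in the ideal `(x, y, z)`. -/
def IsMinimalMap {ι κ : Type} [DecidableEq κ] (φ : (κ → S) →ₗ[S] (ι → S)) : Prop :=
  ∀ j i, MvPolynomial.constantCoeff (φ (Pi.single j 1) i) = 0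

/-- A minimal graded free resolution of the Milnor algebra of the form `f` of degree `d`,
`0 → ⊕ᵢ S(-eᵢ) → ⊕ⱼ S(1 - d - dⱼ) → S³(1 - d) → S`,
where `j` runs over `k + 2` and `i` over `k` indices, `d₁ ≤ d₂ ≤ …` and `e₁ ≤ e₂ ≤ …`
(indices start at `0` below), and the last map is `(a, b, c) ↦ a f_x + b f_y + c f_z`. -/
structure MinimalResolution (f : S) (d : ℕ) where
  k : ℕ
  deg : Fin (k + 2) → ℕ
  e : Fin k → ℕ
  deg_mono : Monotone deg
  e_mono : Monotone e
  φ₂ : (Fin (k + 2) → S) →ₗ[S] (Fin 3 → S)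
  φ₃ : (Fin k → S) →ₗ[S] (Fin (k + 2) → S)
  graded₂ : IsGradedMap (fun j => d - 1 + deg j) (fun _ => d - 1) φ₂
  graded₃ : IsGradedMap e (fun j => d - 1 + deg j) φ₃
  exact₁ : Function.Exact φ₂ (gradientMap f)
  exact₂ : Function.Exact φ₃ φ₂
  injective₃ : Function.Injective φ₃
  minimal₁ : ∀ i, MvPolynomial.constantCoeff (MvPolynomial.pderiv i f) = 0
  minimal₂ : IsMinimalMap φ₂
  minimal₃ : IsMinimalMap φ₃

/-- The integers `ε_j` given by `e_j = d + d_{j+2} - 1 + ε_j`. -/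
def MinimalResolution.ε {f : S} {d : ℕ} (R : MinimalResolution f d) (j : Fin R.k) : ℤ :=
  (R.e j : ℤ) - ((d : ℤ) + (R.deg (j.natAdd 2 |>.cast (Nat.add_comm 2 R.k)) : ℤ) - 1)

end PlaneCurve

namespace PlaneCurve

open MvPolynomial

/-! The resolution exists because `D₀(f)` is a second syzygy module of rank 2 over a ring of
dimension 3: a minimal system of relations between the `m` generators is itself free of relations
(`injective_of_exact`), and counting ranks leaves `m - 2` of them. The comparison
`MinimalResolution.card_and_deg` forces the same numbers on every minimal resolution.

Additivity of dimension makes the Hilbert function of `M(f)` eventually linear in the degree. For a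
reduced curve it is bounded, since `J_f` contains two coprime forms of degree `d - 1`. So the slope
vanishes (`sum_e_eq`), which fixes the sum of the `e_i`. Minimality gives `e_i ≥ d + r`
(`MinimalResolution.lt_e`), and the total excess over this bound is `2r - d + 3 - m = Δm = 1`. Hence
exactly one `e_i`, the last by monotonicity, exceeds the bound, and by 1. The constant term of the
Hilbert polynomial is then `τ`. -/

/-! ### Graded pieces of free modules. -/

theorem homogeneousComponent_mul_of_isHomogeneous {σ R : Type*} [CommSemiring R]
    (p : MvPolynomial σ R) {h : MvPolynomial σ R} {k : ℕ} (hh : h.IsHomogeneous k) (n : ℕ) :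
    homogeneousComponent n (p * h) =
      if k ≤ n then homogeneousComponent (n - k) p * h else 0 := by
  classical
  have key : ∀ i, homogeneousComponent n (homogeneousComponent i p * h) =
      if n = i + k then homogeneousComponent i p * h else 0 := fun i => by
    have hi : (homogeneousComponent i p * h).IsHomogeneous (i + k) :=
      (homogeneousComponent_isHomogeneous i p).mul hh
    rw [homogeneousComponent_of_mem hi]
  conv_lhs => rw [← sum_homogeneousComponent p, Finset.sum_mul, map_sum]
  simp only [key]
  split_ifs with hk
  · have : ∀ i, (n = i + k) ↔ (n - k = i) := fun i => by omega
    simp only [this, Finset.sum_ite_eq, Finset.mem_range]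
    split_ifs with hlt
    · rfl
    · rw [homogeneousComponent_eq_zero _ _ (by omega), zero_mul]
  · exact Finset.sum_eq_zero fun i _ => if_neg (by omega)

/-- The projection of `⊕ᵢ S(-a i)` onto its component of degree `n`. -/
noncomputable def vecComponent {ι : Type} (a : ι → ℕ) (n : ℕ) : (ι → S) →ₗ[ℂ] (ι → S) :=
  LinearMap.pi fun i =>
    if a i ≤ n then (homogeneousComponent (n - a i)).comp (LinearMap.proj i) else 0

theorem vecComponent_apply {ι : Type} (a : ι → ℕ) (n : ℕ) (v : ι → S) (i : ι) :
    vecComponent a n v i = if a i ≤ n then homogeneousComponent (n - a i) (v i) else 0 := by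
  simp only [vecComponent, LinearMap.pi_apply]
  split_ifs <;> rfl

theorem isHomogeneousVec_vecComponent {ι : Type} (a : ι → ℕ) (n : ℕ) (v : ι → S) :
    IsHomogeneousVec a n (vecComponent a n v) := fun i => by
  rw [vecComponent_apply]
  split_ifs with h
  · exact Or.inl ⟨h, homogeneousComponent_isHomogeneous _ _⟩
  · exact Or.inr rfl

theorem IsHomogeneousVec.vecComponent_eq_self {ι : Type} {a : ι → ℕ} {n : ℕ} {v : ι → S}
    (hv : IsHomogeneousVec a n v) : vecComponent a n v = v := by
  funext i
  rw [vecComponent_apply]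
  rcases hv i with ⟨h, h'⟩ | h
  · rw [if_pos h, homogeneousComponent_eq_self h']
  · simp [h]

theorem IsHomogeneousVec.vecComponent_eq_zero {ι : Type} {a : ι → ℕ} {n n' : ℕ} {v : ι → S}
    (hv : IsHomogeneousVec a n v) (hn : n ≠ n') : vecComponent a n' v = 0 := by
  funext i
  rw [vecComponent_apply]
  rcases hv i with ⟨h, h'⟩ | h
  · split_ifs with h''
    · rw [homogeneousComponent_of_mem h', if_neg (by omega)]; rfl
    · rfl
  · simp [h]

theorem sum_vecComponent {ι : Type} [Fintype ι] (a : ι → ℕ) (v : ι → S) :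
    ∃ N, ∑ n ∈ Finset.range N, vecComponent a n v = v := by
  -- Any common bound for the shifted degrees of the coordinates would do; the sum is a convenient
  -- one.
  refine ⟨∑ i, (a i + (v i).totalDegree + 1), ?_⟩
  funext i
  have hi : a i + (v i).totalDegree + 1 ≤ ∑ i, (a i + (v i).totalDegree + 1) :=
    Finset.single_le_sum (f := fun i => a i + (v i).totalDegree + 1)
      (fun _ _ => Nat.zero_le _) (Finset.mem_univ i)
  obtain ⟨M, hM⟩ := Nat.exists_eq_add_of_le hi
  rw [Finset.sum_apply, hM]
  simp only [vecComponent_apply]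
  rw [show a i + (v i).totalDegree + 1 + M = a i + ((v i).totalDegree + 1 + M) by ring,
    Finset.sum_range_add, Finset.sum_eq_zero (fun n hn => if_neg (by simpa using hn)), zero_add]
  simp only [Nat.le_add_right, if_true, Nat.add_sub_cancel_left]
  conv_rhs => rw [← sum_homogeneousComponent (v i)]
  rw [Finset.sum_range_add, add_eq_left]
  exact Finset.sum_eq_zero fun n _ => homogeneousComponent_eq_zero _ _ (by omega)

/-- Commuting with the projections is what makes kernels graded and lets exactness be counted degree
by degree. -/
theorem IsGradedMap.map_vecComponent {ι κ : Type} [Fintype κ] [DecidableEq κ] {b : κ → ℕ}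
    {a : ι → ℕ} {φ : (κ → S) →ₗ[S] (ι → S)} (hφ : IsGradedMap b a φ) (n : ℕ) (v : κ → S) :
    φ (vecComponent b n v) = vecComponent a n (φ v) := by
  have key : ∀ w : κ → S, ∀ i, φ w i = ∑ j, w j * φ (Pi.single j 1) i := fun w i => by
    conv_lhs => rw [pi_eq_sum_univ' w]
    simp
  funext i
  rw [vecComponent_apply, key, key, map_sum, Finset.sum_congr rfl
    (g := fun j => if a i ≤ n then homogeneousComponent (n - a i) (v j * φ (Pi.single j 1) i)
      else 0) fun j _ => ?_]
  · split_ifs <;> simp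
  rw [vecComponent_apply]
  rcases hφ j i with ⟨h, h'⟩ | h
  · rw [homogeneousComponent_mul_of_isHomogeneous _ h']
    by_cases hb : b j ≤ n
    · rw [if_pos hb, if_pos (h.trans hb), if_pos (by omega),
        show n - a i - (b j - a i) = n - b j by omega]
    · rw [if_neg hb, zero_mul]
      split_ifs
      · omega
      · rfl
      · rfl
  · simp [h]

theorem isGradedMap_linearCombination {ι κ : Type} [Fintype κ] [DecidableEq κ] {b : κ → ℕ}
    {a : ι → ℕ} {g : κ → ι → S} (hg : ∀ j, IsHomogeneousVec a (b j) (g j)) :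
    IsGradedMap b a (Fintype.linearCombination S g) := fun j => by
  simpa [Fintype.linearCombination_apply_single] using hg j

/-- A relation between minimal homogeneous generators has no coefficient with a constant term. -/
theorem constantCoeff_eq_zero_of_relation {ι κ : Type} [Fintype κ] [DecidableEq κ] {b : κ → ℕ}
    {a : ι → ℕ} {g : κ → ι → S} (hg : ∀ j, IsHomogeneousVec a (b j) (g j))
    (hmin : ∀ j, g j ∉ Submodule.span S (g '' {j}ᶜ)) {u : κ → S}
    (hu : Fintype.linearCombination S g u = 0) (j : κ) : constantCoeff (u j) = 0 := by
  by_contra hne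
  -- In degree `b j` only the constant term of `u j` survives; if invertible, it lets `g j` be
  -- solved for.
  have h0 : Fintype.linearCombination S g (vecComponent b (b j) u) = 0 := by
    rw [(isGradedMap_linearCombination hg).map_vecComponent, hu, map_zero]
  have hj : vecComponent b (b j) u j = C (constantCoeff (u j)) := by
    simp [vecComponent_apply, constantCoeff_eq]
  rw [Fintype.linearCombination_apply, ← Finset.add_sum_erase _ _ (Finset.mem_univ j), hj] at h0
  have h1 : (C (constantCoeff (u j)) : S) • g j ∈ Submodule.span S (g '' {j}ᶜ) := by
    rw [eq_neg_of_add_eq_zero_left h0]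
    refine neg_mem (Submodule.sum_mem _ fun l hl => Submodule.smul_mem _ _ ?_)
    exact Submodule.subset_span ⟨l, by simpa using hl, rfl⟩
  apply hmin j
  have h2 := Submodule.smul_mem _ (C (constantCoeff (u j))⁻¹ : S) h1
  rwa [smul_smul, ← C_mul, inv_mul_cancel₀ hne, C_1, one_smul] at h2

/-! ### The Koszul complex and the length of the resolution. -/

/-- Membership in a monomial ideal is tested on monomials, and multiplying by `X 0` leaves the
exponents of `X 1` and `X 2` unchanged. -/
theorem mem_span_pair_of_X_mul_mem {a : S}
    (h : X 0 * a ∈ Ideal.span {(X 1 : S), X 2}) : a ∈ Ideal.span {(X 1 : S), X 2} := by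
  have hset : ({X 1, X 2} : Set S) = X '' {1, 2} := by simp [Set.image_pair]
  rw [hset, mem_ideal_span_X_image] at h ⊢
  intro m hm
  obtain ⟨i, hi, hne⟩ := h (Finsupp.single 0 1 + m) (by
    rw [mem_support_iff, coeff_X_mul]; exact mem_support_iff.mp hm)
  refine ⟨i, hi, ?_⟩
  rcases hi with rfl | rfl <;> simpa using hne

/-- Exactness of the Koszul complex of `x, y, z` at its second place. -/
theorem koszul_exact {a b c : S} (h : X 0 * a + X 1 * b + X 2 * c = 0) :
    ∃ α β γ : S, a = X 1 * γ - X 2 * β ∧ b = X 2 * α - X 0 * γ ∧ c = X 0 * β - X 1 * α := by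
  have ha : a ∈ Ideal.span {(X 1 : S), X 2} := by
    apply mem_span_pair_of_X_mul_mem
    exact Ideal.mem_span_pair.mpr ⟨-b, -c, by linear_combination -h⟩
  obtain ⟨γ, β, rfl⟩ := Ideal.mem_span_pair.mp ha
  have h0 : ∀ i : Fin 3, (X i : S) ≠ 0 := fun i => X_ne_zero i
  have h1 : X 1 * (b + X 0 * γ) + X 2 * (c + X 0 * β) = 0 := by linear_combination h
  obtain ⟨α, hα⟩ : (X 2 : S) ∣ b + X 0 * γ := by
    have hdvd : (X 2 : S) ∣ X 1 * (b + X 0 * γ) :=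
      ⟨-(c + X 0 * β), by linear_combination h1⟩
    refine ((X_prime (R := ℂ) (i := (2 : Fin 3))).dvd_or_dvd hdvd).resolve_left ?_
    rw [X_dvd_X]; simp
  refine ⟨α, -β, γ, by ring, by linear_combination hα, ?_⟩
  apply mul_left_cancel₀ (h0 2)
  linear_combination h1 - X 1 * hα

/-- Exactness of the Koszul complex of `x, y, z` at its third place. -/
theorem koszul_exact' {α β γ : S} (h2 : X 2 * α = X 0 * γ)
    (h3 : X 0 * β = X 1 * α) : ∃ g : S, α = X 0 * g ∧ β = X 1 * g ∧ γ = X 2 * g := by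
  obtain ⟨g, rfl⟩ : (X 0 : S) ∣ α := by
    refine ((X_prime (R := ℂ) (i := (0 : Fin 3))).dvd_or_dvd
      (Dvd.intro β h3)).resolve_left ?_
    rw [X_dvd_X]; simp
  have h0 : (X 0 : S) ≠ 0 := X_ne_zero 0
  refine ⟨g, rfl, mul_left_cancel₀ h0 ?_, mul_left_cancel₀ h0 ?_⟩
  · linear_combination h3
  · linear_combination -h2

theorem exists_of_constantCoeff_eq_zero {p : S} (h : constantCoeff p = 0) :
    ∃ a b c : S, p = X 0 * a + X 1 * b + X 2 * c := by
  have hset : (X '' (Set.univ : Set (Fin 3)) : Set S) = {X 0, X 1, X 2} := by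
    ext q; simp [Fin.exists_fin_succ, eq_comm]
  have hp : p ∈ Ideal.span (X '' (Set.univ : Set (Fin 3)) : Set S) := by
    rw [mem_ideal_span_X_image]
    intro m hm
    by_contra! hc
    have : m = 0 := by ext i; simpa using hc i
    rw [this, mem_support_iff] at hm
    exact hm h
  rw [hset] at hp
  obtain ⟨a, b, c, h⟩ := Submodule.mem_span_triple.mp hp
  exact ⟨a, b, c, by rw [← h]; simp only [smul_eq_mul]; ring⟩

/-- A third syzygy module over `S = ℂ[x, y, z]` has no relations between generators for which all
relations have coefficients without constant term. -/
theorem injective_of_exact {ι κ τ : Type} {ψ : (ι → S) →ₗ[S] S} {φ : (κ → S) →ₗ[S] (ι → S)}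
    {χ : (τ → S) →ₗ[S] (κ → S)} (h₁ : Function.Exact φ ψ) (h₂ : Function.Exact χ φ)
    (hmin : ∀ u, χ u = 0 → ∀ i, constantCoeff (u i) = 0) : Function.Injective χ := by
  -- The kernel of `χ` equals `(x, y, z)` times itself: a chase through the double complex of the
  -- Koszul complex and the given one.
  have step : ∀ u, χ u = 0 → ∃ a b c, χ a = 0 ∧ χ b = 0 ∧ χ c = 0 ∧
      u = (X 0 : S) • a + (X 1 : S) • b + (X 2 : S) • c := by
    intro u hu
    choose a b c habc using fun i => exists_of_constantCoeff_eq_zero (hmin u hu i)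
    have hu' : u = (X 0 : S) • a + (X 1 : S) • b + (X 2 : S) • c := funext habc
    have hK : ∀ j, X 0 * χ a j + X 1 * χ b j + X 2 * χ c j = 0 := fun j => by
      have := congrFun hu j
      rw [hu'] at this
      simpa using this
    choose α β γ h using fun j => koszul_exact (hK j)
    have ea : χ a = (X 1 : S) • γ - (X 2 : S) • β := funext fun j => (h j).1
    have eb : χ b = (X 2 : S) • α - (X 0 : S) • γ := funext fun j => (h j).2.1
    have ec : χ c = (X 0 : S) • β - (X 1 : S) • α := funext fun j => (h j).2.2
    have fb := h₂.apply_apply_eq_zero b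
    have fc := h₂.apply_apply_eq_zero c
    rw [eb, map_sub, map_smul, map_smul, sub_eq_zero] at fb
    rw [ec, map_sub, map_smul, map_smul, sub_eq_zero] at fc
    choose g hg using fun j => koszul_exact' (congrFun fb j) (congrFun fc j)
    have hα : φ α = (X 0 : S) • g := funext fun j => (hg j).1
    have hβ : φ β = (X 1 : S) • g := funext fun j => (hg j).2.1
    have hγ : φ γ = (X 2 : S) • g := funext fun j => (hg j).2.2
    have hψ : ψ g = 0 := by
      have := h₁.apply_apply_eq_zero α
      rw [hα, map_smul, smul_eq_mul] at this
      exact (mul_eq_zero.mp this).resolve_left (X_ne_zero 0)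
    -- On the way back, `δ` corrects `α, β, γ` into the kernel of `φ`. Their lifts then change `a,
    -- b, c` by a Koszul boundary, which does not affect `u`.
    obtain ⟨δ, rfl⟩ := (h₁ g).mp hψ
    obtain ⟨α', hα'⟩ := (h₂ (α - (X 0 : S) • δ)).mp (by rw [map_sub, map_smul, hα, sub_self])
    obtain ⟨β', hβ'⟩ := (h₂ (β - (X 1 : S) • δ)).mp (by rw [map_sub, map_smul, hβ, sub_self])
    obtain ⟨γ', hγ'⟩ := (h₂ (γ - (X 2 : S) • δ)).mp (by rw [map_sub, map_smul, hγ, sub_self])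
    refine ⟨a - ((X 1 : S) • γ' - (X 2 : S) • β'), b - ((X 2 : S) • α' - (X 0 : S) • γ'),
      c - ((X 0 : S) • β' - (X 1 : S) • α'), ?_, ?_, ?_, ?_⟩
    · simp only [map_sub, map_smul, ea, hγ', hβ']; module
    · simp only [map_sub, map_smul, eb, hγ', hα']; module
    · simp only [map_sub, map_smul, ec, hα', hβ']; module
    · rw [hu']; module
  set I : Ideal S := Ideal.span (Set.range X) with hI
  have hX : ∀ i, (X i : S) ∈ I := fun i => Ideal.subset_span ⟨i, rfl⟩
  have hne : I ≠ ⊤ := by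
    intro h
    have : I ≤ RingHom.ker (constantCoeff : S →+* ℂ) := by
      rw [hI, Ideal.span_le]
      rintro _ ⟨i, rfl⟩
      simp
    have h1 := this (h ▸ Submodule.mem_top : (1 : S) ∈ I)
    simp at h1
  -- Iterating puts the coordinates in every power of `I`, and Krull's intersection theorem
  -- finishes.
  have hpow : ∀ N u, χ u = 0 → ∀ i, u i ∈ I ^ N := by
    intro N
    induction N with
    | zero => simp
    | succ N ih =>
      intro u hu i
      obtain ⟨a, b, c, ha, hb, hc, rfl⟩ := step u hu
      rw [pow_succ']
      exact add_mem (add_mem (Ideal.mul_mem_mul (hX 0) (ih a ha i))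
        (Ideal.mul_mem_mul (hX 1) (ih b hb i))) (Ideal.mul_mem_mul (hX 2) (ih c hc i))
  rw [injective_iff_map_eq_zero]
  intro u hu
  funext i
  have : u i ∈ ⨅ N, I ^ N := Ideal.mem_iInf.mpr fun N => hpow N u hu i
  rwa [Ideal.iInf_pow_eq_bot_of_isDomain _ hne, Ideal.mem_bot] at this

/-! ### Ranks, minimal generators and existence of the resolution. -/

theorem finrank_range_add_finrank_ker_of_free {ι M : Type*} [Fintype ι] [AddCommGroup M]
    [Module S M] (φ : (ι → S) →ₗ[S] M) :
    Module.finrank S (LinearMap.range φ) + Module.finrank S (LinearMap.ker φ) =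
      Fintype.card ι := by
  rw [← (φ.quotKerEquivRange).finrank_eq, Submodule.finrank_quotient_add_finrank,
    Module.finrank_pi]

/-- A graded submodule of a graded free module of finite rank has a finite minimal system of
homogeneous generators, ordered by degree. -/
theorem exists_minimal_homogeneous_generators {κ : Type} [Fintype κ] (b : κ → ℕ)
    (K : Submodule S (κ → S)) (hK : ∀ n, ∀ v ∈ K, vecComponent b n v ∈ K) :
    ∃ (n : ℕ) (e : Fin n → ℕ) (g : Fin n → κ → S), Monotone e ∧
      (∀ j, IsHomogeneousVec b (e j) (g j)) ∧ Submodule.span S (Set.range g) = K ∧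
      ∀ j, g j ∉ Submodule.span S (g '' {j}ᶜ) := by
  classical
  have hex : ∃ n, ∃ (e : Fin n → ℕ) (g : Fin n → κ → S),
      (∀ j, IsHomogeneousVec b (e j) (g j)) ∧ Submodule.span S (Set.range g) = K := by
    obtain ⟨T, hT⟩ := IsNoetherian.noetherian K
    choose N hN using fun v : κ → S => sum_vecComponent b v
    let A : Finset (κ → S) := T.biUnion fun v =>
      (Finset.range (N v)).image fun n => vecComponent b n v
    have hA : ∀ w ∈ A, ∃ v ∈ T, ∃ n, vecComponent b n v = w := fun w hw => by
      simp only [A, Finset.mem_biUnion, Finset.mem_image] at hw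
      obtain ⟨v, hv, n, _, h⟩ := hw
      exact ⟨v, hv, n, h⟩
    have hdeg : ∀ w : A, ∃ n, IsHomogeneousVec b n (w : κ → S) := fun w => by
      obtain ⟨v, _, n, h⟩ := hA w w.2
      exact ⟨n, h ▸ isHomogeneousVec_vecComponent b n v⟩
    choose deg hdeg using hdeg
    refine ⟨A.card, fun j => deg (A.equivFin.symm j), fun j => (A.equivFin.symm j : κ → S),
      fun j => hdeg _, ?_⟩
    have hrange : Set.range (fun j => (A.equivFin.symm j : κ → S)) = (A : Set (κ → S)) := by
      ext w
      constructor
      · rintro ⟨j, rfl⟩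
        exact (A.equivFin.symm j).2
      · intro hw
        exact ⟨A.equivFin ⟨w, hw⟩, by simp⟩
    rw [hrange]
    apply le_antisymm
    · rw [Submodule.span_le]
      intro w hw
      obtain ⟨v, hv, n, rfl⟩ := hA w hw
      exact hK n v (hT ▸ Submodule.subset_span hv)
    · rw [← hT, Submodule.span_le]
      intro v hv
      rw [SetLike.mem_coe, ← hN v]
      refine Submodule.sum_mem _ fun n hn => Submodule.subset_span ?_
      simp only [A, Finset.coe_biUnion, Set.mem_iUnion]
      exact ⟨v, hv, by simpa using ⟨n, by simpa using hn, rfl⟩⟩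
  -- The least possible number of homogeneous generators is taken, so none can be dropped; sorting
  -- by degree keeps their range.
  obtain ⟨e, g, hg, hspan⟩ := Nat.find_spec hex
  have hsort : Set.range (g ∘ Tuple.sort e) = Set.range g := (Tuple.sort e).surjective.range_comp g
  refine ⟨Nat.find hex, e ∘ Tuple.sort e, g ∘ Tuple.sort e, Tuple.monotone_sort e,
    fun j => hg _, hsort.symm ▸ hspan, ?_⟩
  have hmin := fun l (hl : l < Nat.find hex) => Nat.find_min hex hl
  rw [← hsort] at hspan
  replace hg : ∀ j, IsHomogeneousVec b ((e ∘ Tuple.sort e) j) ((g ∘ Tuple.sort e) j) :=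
    fun j => hg _
  generalize g ∘ Tuple.sort e = g at *
  generalize e ∘ Tuple.sort e = e at *
  clear hsort
  generalize Nat.find hex = n at *
  intro j hj
  obtain _ | n := n
  · exact j.elim0
  refine hmin n n.lt_succ_self ⟨e ∘ j.succAbove, g ∘ j.succAbove, fun i => hg _, ?_⟩
  have himage : Set.range (g ∘ j.succAbove) = g '' {j}ᶜ := by
    rw [Set.range_comp, Fin.range_succAbove]
  rw [himage, ← hspan]
  apply le_antisymm (Submodule.span_mono (Set.image_subset_range _ _))
  rw [Submodule.span_le]
  rintro _ ⟨i, rfl⟩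
  by_cases hi : i = j
  · exact hi ▸ hj
  · exact Submodule.subset_span ⟨i, hi, rfl⟩

theorem pderiv_ne_zero_of_isHomogeneous {f : S} {d : ℕ} (hd : d ≠ 0) (hf : f.IsHomogeneous d)
    (h0 : f ≠ 0) : ∃ i, pderiv i f ≠ 0 := by
  by_contra! h
  have := hf.sum_X_mul_pderiv
  simp only [h, mul_zero, Finset.sum_const_zero] at this
  exact smul_ne_zero hd h0 this.symm

/-- The image of the gradient map is a nonzero ideal of a domain, hence of rank 1. -/
theorem finrank_jacobianSyzygies {f : S} {i : Fin 3} (hi : pderiv i f ≠ 0) :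
    Module.finrank S (jacobianSyzygies f) = 2 := by
  have h := finrank_range_add_finrank_ker_of_free (gradientMap f)
  have hle : Module.finrank S (LinearMap.range (gradientMap f)) ≤ 1 := by
    simpa using Submodule.finrank_le (LinearMap.range (gradientMap f))
  have hpos : 0 < Module.finrank S (LinearMap.range (gradientMap f)) := by
    rw [Module.finrank_pos_iff, Submodule.nontrivial_iff_ne_bot]
    intro hbot
    apply hi
    have : gradientMap f (Pi.single i 1) ∈ LinearMap.range (gradientMap f) := ⟨_, rfl⟩
    rw [hbot, Submodule.mem_bot] at this
    simpa [gradientMap, Fintype.linearCombination_apply_single] using this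
  rw [Fintype.card_fin] at h
  change Module.finrank S (LinearMap.ker (gradientMap f)) = 2
  omega

theorem IsMinimalGenerators.isHomogeneousVec {f : S} {m : ℕ} {deg : Fin m → ℕ}
    {ρ : Fin m → Fin 3 → S} (h : IsMinimalGenerators f deg ρ) (c : ℕ) (j : Fin m) :
    IsHomogeneousVec (fun _ : Fin 3 => c) (c + deg j) (ρ j) := fun i =>
  Or.inl ⟨Nat.le_add_right _ _, by simpa using h.homogeneous j i⟩

theorem IsMinimalGenerators.exact {f : S} {m : ℕ} {deg : Fin m → ℕ}
    {ρ : Fin m → Fin 3 → S} (h : IsMinimalGenerators f deg ρ) :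
    Function.Exact (Fintype.linearCombination S ρ) (gradientMap f) := by
  rw [LinearMap.exact_iff, Fintype.range_linearCombination, h.span_eq]
  rfl

/-- Homogeneous syzygies of positive degree which generate `D₀(f)` minimally extend to a minimal
graded free resolution of the Milnor algebra. -/
theorem nonempty_minimalResolution {f : S} {d r m : ℕ} (hd : 3 ≤ d) (hf : f.IsHomogeneous d)
    (h0 : f ≠ 0) (hr : r ≠ 0) {ρ : Fin m → Fin 3 → S}
    (hρ : IsMinimalGenerators f (fun _ => r) ρ) : Nonempty (MinimalResolution f d) := by
  have hgr : IsGradedMap (fun _ : Fin m => d - 1 + r) (fun _ : Fin 3 => d - 1)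
      (Fintype.linearCombination S ρ) :=
    isGradedMap_linearCombination (hρ.isHomogeneousVec (d - 1))
  obtain ⟨n, e, g, he, hg, hspan, hmin⟩ := exists_minimal_homogeneous_generators
    (fun _ : Fin m => d - 1 + r) (LinearMap.ker (Fintype.linearCombination S ρ))
    fun l v hv => by
      rw [LinearMap.mem_ker] at hv ⊢
      rw [hgr.map_vecComponent, hv, map_zero]
  have hex : Function.Exact (Fintype.linearCombination S g) (Fintype.linearCombination S ρ) := by
    rw [LinearMap.exact_iff, Fintype.range_linearCombination, hspan]
  have hinj : Function.Injective (Fintype.linearCombination S g) :=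
    injective_of_exact hρ.exact hex fun u hu => constantCoeff_eq_zero_of_relation hg hmin hu
  obtain ⟨i, hi⟩ := pderiv_ne_zero_of_isHomogeneous (by omega) hf h0
  have hn : m = n + 2 := by
    have h := finrank_range_add_finrank_ker_of_free (Fintype.linearCombination S ρ)
    rw [Fintype.range_linearCombination, hρ.span_eq, finrank_jacobianSyzygies hi,
      LinearMap.exact_iff.mp hex, LinearMap.finrank_range_of_inj hinj, Module.finrank_pi] at h
    simp only [Fintype.card_fin] at h
    omega
  subst hn
  have hconst : ∀ {p : S} {l : ℕ}, p.IsHomogeneous l → l ≠ 0 → constantCoeff p = 0 :=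
    fun hp hl => hp.coeff_eq_zero (by simpa using hl.symm)
  exact ⟨{
    k := n
    deg := fun _ => r
    e := e
    deg_mono := fun _ _ _ => le_rfl
    e_mono := he
    φ₂ := Fintype.linearCombination S ρ
    φ₃ := Fintype.linearCombination S g
    graded₂ := hgr
    graded₃ := isGradedMap_linearCombination hg
    exact₁ := hρ.exact
    exact₂ := hex
    injective₃ := hinj
    minimal₁ := fun i => hconst hf.pderiv (by omega)
    minimal₂ := fun j i => by
      rw [Fintype.linearCombination_apply_single, one_smul]
      exact hconst (hρ.homogeneous j i) hr
    minimal₃ := fun j i => by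
      rw [Fintype.linearCombination_apply_single, one_smul]
      refine constantCoeff_eq_zero_of_relation (hρ.isHomogeneousVec (d - 1)) hρ.minimal ?_ i
      exact LinearMap.mem_ker.mp (hspan ▸ Submodule.subset_span ⟨j, rfl⟩) }⟩

/-! ### Invariance of the number and degrees of first syzygies. -/

theorem MinimalResolution.constantCoeff_eq_zero_of_relation {f : S} {d : ℕ}
    (R : MinimalResolution f d) {u : Fin (R.k + 2) → S} (hu : R.φ₂ u = 0) (j : Fin (R.k + 2)) :
    constantCoeff (u j) = 0 := by
  obtain ⟨w, rfl⟩ := (R.exact₂ u).mp hu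
  conv_lhs => rw [pi_eq_sum_univ' w]
  simp [R.minimal₃ _ j]

/-- A minimal resolution has as many first syzygies as any minimal system of generators of `D₀(f)`
of constant degree, and they are of the same degree. -/
theorem MinimalResolution.card_and_deg {f : S} {d r m : ℕ} (R : MinimalResolution f d)
    {ρ : Fin m → Fin 3 → S} (hρ : IsMinimalGenerators f (fun _ => r) ρ) :
    R.k + 2 = m ∧ ∀ j, R.deg j = r := by
  have hrel : ∀ {u : Fin m → S}, Fintype.linearCombination S ρ u = 0 →
      ∀ i, constantCoeff (u i) = 0 := fun hu =>
    PlaneCurve.constantCoeff_eq_zero_of_relation (hρ.isHomogeneousVec (d - 1)) hρ.minimal hu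
  have hsum : ∀ u, R.φ₂ u = ∑ j, u j • R.φ₂ (Pi.single j 1) := fun u => by
    conv_lhs => rw [pi_eq_sum_univ' u]
    simp only [map_sum, map_smul]
  choose A hA using fun j => (hρ.exact (R.φ₂ (Pi.single j 1))).mp (R.exact₁.apply_apply_eq_zero _)
  choose B hB using fun i => (R.exact₁ (ρ i)).mp (by
    have := hρ.exact.apply_apply_eq_zero (Pi.single i 1)
    rwa [Fintype.linearCombination_apply_single, one_smul] at this)
  -- Modulo `(x, y, z)` the two transition matrices are mutually inverse, because relations on
  -- either side have no constant terms.
  let A' : Matrix (Fin (R.k + 2)) (Fin m) ℂ := Matrix.of fun j i => constantCoeff (A j i)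
  let B' : Matrix (Fin m) (Fin (R.k + 2)) ℂ := Matrix.of fun i j => constantCoeff (B i j)
  have hBA : B' * A' = 1 := by
    ext i i'
    have h0 : Fintype.linearCombination S ρ (∑ j, B i j • A j - Pi.single i 1) = 0 := by
      rw [map_sub, map_sum, Fintype.linearCombination_apply_single, one_smul, sub_eq_zero,
        ← hB i, hsum]
      exact Finset.sum_congr rfl fun j _ => by rw [map_smul, hA]
    have h1 := hrel h0 i'
    simp only [Pi.sub_apply, Finset.sum_apply, Pi.smul_apply, smul_eq_mul, map_sub, map_sum,
      map_mul, sub_eq_zero] at h1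
    simp only [Matrix.mul_apply, A', B', Matrix.of_apply, h1, Matrix.one_apply, Pi.single_apply]
    by_cases h : i = i'
    · simp [h]
    · simp [h, Ne.symm h]
  have hAB : A' * B' = 1 := by
    ext j j'
    have h0 : R.φ₂ (∑ i, A j i • B i - Pi.single j 1) = 0 := by
      rw [map_sub, map_sum, sub_eq_zero, ← hA j, Fintype.linearCombination_apply]
      exact Finset.sum_congr rfl fun i _ => by rw [map_smul, hB]
    have h1 := R.constantCoeff_eq_zero_of_relation h0 j'
    simp only [Pi.sub_apply, Finset.sum_apply, Pi.smul_apply, smul_eq_mul, map_sub, map_sum,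
      map_mul, sub_eq_zero] at h1
    simp only [Matrix.mul_apply, A', B', Matrix.of_apply, h1, Matrix.one_apply, Pi.single_apply]
    by_cases h : j = j'
    · simp [h]
    · simp [h, Ne.symm h]
  refine ⟨?_, fun j => ?_⟩
  · simpa using Matrix.square_of_invertible A' B' hAB hBA
  · by_contra hne
    -- If the `j`-th degree were not `r`, the part of row `j` of `A` in degree `d - 1 + r` would be
    -- a relation, so row `j` of the invertible `A'` would vanish.
    have h0 : Fintype.linearCombination S ρ
        (vecComponent (fun _ => d - 1 + r) (d - 1 + r) (A j)) = 0 := by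
      rw [(isGradedMap_linearCombination (hρ.isHomogeneousVec (d - 1))).map_vecComponent, hA]
      exact (R.graded₂ j).vecComponent_eq_zero fun h => hne (Nat.add_left_cancel h)
    have hz : ∀ i, A' j i = 0 := fun i => by
      simpa [vecComponent_apply, A', constantCoeff_eq] using hrel h0 i
    have h1 := congrFun (congrFun hAB j) j
    simp [Matrix.mul_apply, hz] at h1

/-! ### Hilbert functions. -/

theorem finite_homogeneousSubmodule (n : ℕ) :
    Module.Finite ℂ (homogeneousSubmodule (Fin 3) ℂ n) :=
  Module.Finite.iff_fg.mpr (homogeneousSubmodule_fg (Fin 3) ℂ n)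

theorem finrank_homogeneousSubmodule (n : ℕ) :
    Module.finrank ℂ (homogeneousSubmodule (Fin 3) ℂ n) = (n + 2).choose 2 := by
  have hset : {d : Fin 3 →₀ ℕ | d.degree = n} =
      ((Finset.univ.finsuppAntidiag n : Finset (Fin 3 →₀ ℕ)) : Set (Fin 3 →₀ ℕ)) := by
    ext d; simp [Finsupp.degree_eq_sum]
  rw [homogeneousSubmodule_eq_finsupp_supported, hset,
    (AddMonoidAlgebra.supportedEquivFinsupp _).finrank_eq,
    Module.finrank_finsupp_self]
  simp only [Finset.coe_sort_coe, Fintype.card_coe, Finset.card_finsuppAntidiag_nat_eq_choose, Finset.card_univ, Fintype.card_fin]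
  rw [show 3 + n - 1 = n + 2 by omega, Nat.choose_symm_add]

theorem finrank_homogeneousSubmodule_sub {a n : ℕ} (h : a ≤ n) :
    (Module.finrank ℂ (homogeneousSubmodule (Fin 3) ℂ (n - a)) : ℚ) =
      ((n : ℚ) - a + 1) * (n - a + 2) / 2 := by
  rw [finrank_homogeneousSubmodule, Nat.cast_choose_two]
  push_cast [Nat.cast_sub h]
  ring

theorem range_homogeneousComponent (n : ℕ) :
    LinearMap.range (homogeneousComponent n : S →ₗ[ℂ] S) = homogeneousSubmodule (Fin 3) ℂ n := by
  ext p
  exact ⟨fun ⟨q, hq⟩ => hq ▸ homogeneousComponent_isHomogeneous n q,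
    fun hp => ⟨p, homogeneousComponent_eq_self hp⟩⟩

theorem finite_finrank_range_vecComponent {ι : Type} [Fintype ι] (a : ι → ℕ) {n : ℕ}
    (hn : ∀ i, a i ≤ n) :
    Module.Finite ℂ (LinearMap.range (vecComponent a n)) ∧
    (Module.finrank ℂ (LinearMap.range (vecComponent a n)) : ℚ) =
      ∑ i, ((n : ℚ) - a i + 1) * (n - a i + 2) / 2 := by
  let L : ((i : ι) → homogeneousSubmodule (Fin 3) ℂ (n - a i)) →ₗ[ℂ] (ι → S) :=
    LinearMap.pi fun i => (Submodule.subtype _).comp (LinearMap.proj i)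
  have hL : Function.Injective L := fun v w h => by
    funext i
    exact Subtype.ext (congrFun h i)
  have hr : LinearMap.range L = LinearMap.range (vecComponent a n) := by
    ext v
    constructor
    · rintro ⟨w, rfl⟩
      exact ⟨L w, IsHomogeneousVec.vecComponent_eq_self fun i => Or.inl ⟨hn i, (w i).2⟩⟩
    · rintro ⟨w, rfl⟩
      refine ⟨fun i => ⟨homogeneousComponent (n - a i) (w i),
        homogeneousComponent_isHomogeneous _ _⟩, ?_⟩
      funext i
      rw [vecComponent_apply, if_pos (hn i)]
      rfl
  have := finite_homogeneousSubmodule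
  rw [← hr, LinearMap.finrank_range_of_inj hL, Module.finrank_pi_fintype]
  refine ⟨inferInstance, ?_⟩
  push_cast
  exact Finset.sum_congr rfl fun i _ => finrank_homogeneousSubmodule_sub (hn i)

theorem vecComponent_vecComponent {ι : Type} (a : ι → ℕ) (n : ℕ) (v : ι → S) :
    vecComponent a n (vecComponent a n v) = vecComponent a n v :=
  (isHomogeneousVec_vecComponent a n v).vecComponent_eq_self

theorem homogeneousComponent_homogeneousComponent (n : ℕ) (p : S) :
    homogeneousComponent n (homogeneousComponent n p) = homogeneousComponent n p :=
  homogeneousComponent_eq_self (homogeneousComponent_isHomogeneous n p)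

theorem homogeneousComponent_linearCombination {ι : Type} [Fintype ι] {g : ι → S} {D : ℕ}
    (hg : ∀ i, (g i).IsHomogeneous D) (n : ℕ) (v : ι → S) :
    Fintype.linearCombination S g (vecComponent (fun _ => D) n v) =
      homogeneousComponent n (Fintype.linearCombination S g v) := by
  simp only [Fintype.linearCombination_apply, map_sum, smul_eq_mul, vecComponent_apply,
    homogeneousComponent_mul_of_isHomogeneous _ (hg _)]
  exact Finset.sum_congr rfl fun i _ => by split_ifs <;> simp

section Exactness

variable {V W X : Type*} [AddCommGroup V] [Module ℂ V] [AddCommGroup W] [Module ℂ W]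
  [AddCommGroup X] [Module ℂ X]

/-- Images of homogeneous components under homogeneous maps. -/
theorem map_range_eq_inf {p : V →ₗ[ℂ] V} {q : W →ₗ[ℂ] W} {T : V →ₗ[ℂ] W}
    (hq : ∀ w, q (q w) = q w) (hT : ∀ v, T (p v) = q (T v)) :
    (LinearMap.range p).map T = LinearMap.range q ⊓ LinearMap.range T := by
  ext w
  constructor
  · rintro ⟨_, ⟨v, rfl⟩, rfl⟩
    exact ⟨⟨T v, (hT v).symm⟩, ⟨p v, rfl⟩⟩
  · rintro ⟨⟨w', rfl⟩, v, hv⟩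
    exact ⟨p v, ⟨v, rfl⟩, by rw [hT, hv, hq]⟩

theorem finrank_map_add_finrank_inf_ker (P : Submodule ℂ V) [Module.Finite ℂ P]
    (L : V →ₗ[ℂ] W) :
    Module.finrank ℂ (P.map L) + Module.finrank ℂ ↥(P ⊓ LinearMap.ker L) =
      Module.finrank ℂ P := by
  rw [← LinearMap.finrank_range_add_finrank_ker (L.domRestrict P), LinearMap.range_domRestrict,
    LinearMap.ker_domRestrict, ← Submodule.map_comap_subtype]
  congr 1
  exact (Submodule.equivMapOfInjective P.subtype P.injective_subtype _).symm.finrank_eq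

/-- The dimension of a homogeneous component of the middle term of an exact sequence. -/
theorem finrank_map_add_finrank_map {p : V →ₗ[ℂ] V} {q : W →ₗ[ℂ] W} {T : V →ₗ[ℂ] W}
    {L : W →ₗ[ℂ] X} [Module.Finite ℂ (LinearMap.range q)]
    (hq : ∀ w, q (q w) = q w) (hT : ∀ v, T (p v) = q (T v))
    (hex : LinearMap.ker L = LinearMap.range T) :
    Module.finrank ℂ ((LinearMap.range q).map L) + Module.finrank ℂ ((LinearMap.range p).map T) =
      Module.finrank ℂ (LinearMap.range q) := by
  rw [map_range_eq_inf hq hT, ← hex, finrank_map_add_finrank_inf_ker]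

end Exactness

theorem ker_eq_range_restrictScalars {V W X : Type*} [AddCommGroup V] [Module S V]
    [AddCommGroup W] [Module S W] [AddCommGroup X] [Module S X] [Module ℂ V] [Module ℂ W]
    [Module ℂ X] [IsScalarTower ℂ S V] [IsScalarTower ℂ S W] [IsScalarTower ℂ S X]
    {T : V →ₗ[S] W} {L : W →ₗ[S] X} (h : Function.Exact T L) :
    LinearMap.ker (L.restrictScalars ℂ) = LinearMap.range (T.restrictScalars ℂ) := by
  ext w
  exact h w

/-- The degree `n` part of the sequence `S(-D)^ι → S → M(f) → 0` is exact. -/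
theorem finrank_milnorComponent_add {f : S} {d : ℕ} (hf : f.IsHomogeneous d) (n : ℕ) :
    Module.finrank ℂ (milnorComponent f n) +
      Module.finrank ℂ ((LinearMap.range (vecComponent (fun _ : Fin 3 => d - 1) n)).map
        ((gradientMap f).restrictScalars ℂ)) =
      Module.finrank ℂ (homogeneousSubmodule (Fin 3) ℂ n) := by
  have : Module.Finite ℂ (LinearMap.range (homogeneousComponent n : S →ₗ[ℂ] S)) := by
    rw [range_homogeneousComponent]; exact finite_homogeneousSubmodule n
  have hT : ∀ v, (gradientMap f).restrictScalars ℂ (vecComponent (fun _ => d - 1) n v) =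
      homogeneousComponent n ((gradientMap f).restrictScalars ℂ v) := fun v => by
    rw [LinearMap.restrictScalars_apply, LinearMap.restrictScalars_apply, gradientMap]
    exact homogeneousComponent_linearCombination (fun i => hf.pderiv) n v
  have hker : LinearMap.ker (Ideal.Quotient.mkₐ ℂ (jacobianIdeal f)).toLinearMap =
      LinearMap.range ((gradientMap f).restrictScalars ℂ) := by
    refine Submodule.ext fun p => ?_
    rw [LinearMap.mem_ker, AlgHom.toLinearMap_apply, Ideal.Quotient.mkₐ_eq_mk,
      Ideal.Quotient.eq_zero_iff_mem, ← range_gradientMap]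
    rfl
  have h := finrank_map_add_finrank_map (homogeneousComponent_homogeneousComponent n) hT hker
  rwa [range_homogeneousComponent] at h

/-- The Hilbert function of the Milnor algebra, from a graded free resolution. -/
theorem MinimalResolution.finrank_milnorComponent {f : S} {d : ℕ} (R : MinimalResolution f d)
    (hf : f.IsHomogeneous d) : ∀ᶠ n : ℕ in Filter.atTop,
      (Module.finrank ℂ (milnorComponent f n) : ℚ) =
        ((n : ℚ) + 1) * (n + 2) / 2
          - ∑ _i : Fin 3, ((n : ℚ) - (d - 1 : ℕ) + 1) * (n - (d - 1 : ℕ) + 2) / 2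
          + ∑ j, ((n : ℚ) - (d - 1 + R.deg j : ℕ) + 1) * (n - (d - 1 + R.deg j : ℕ) + 2) / 2
          - ∑ i, ((n : ℚ) - R.e i + 1) * (n - R.e i + 2) / 2 := by
  filter_upwards [Filter.eventually_ge_atTop (d - 1),
    Filter.eventually_all.mpr fun j => Filter.eventually_ge_atTop (d - 1 + R.deg j),
    Filter.eventually_all.mpr fun i => Filter.eventually_ge_atTop (R.e i)] with n h1 h2 h3
  obtain ⟨F1, e1⟩ := finite_finrank_range_vecComponent (fun _ : Fin 3 => d - 1) (n := n)
    fun _ => h1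
  obtain ⟨F2, e2⟩ := finite_finrank_range_vecComponent (fun j => d - 1 + R.deg j) (n := n) h2
  obtain ⟨F3, e3⟩ := finite_finrank_range_vecComponent R.e (n := n) h3
  have e0 := finrank_homogeneousSubmodule_sub (Nat.zero_le n)
  have g0 := finrank_milnorComponent_add hf n
  have g1 := finrank_map_add_finrank_map (p := vecComponent (fun j => d - 1 + R.deg j) n)
    (vecComponent_vecComponent (fun _ : Fin 3 => d - 1) n)
    (T := R.φ₂.restrictScalars ℂ) (R.graded₂.map_vecComponent n)
    (ker_eq_range_restrictScalars R.exact₁)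
  have g2 := finrank_map_add_finrank_map (p := vecComponent R.e n)
    (vecComponent_vecComponent (fun j => d - 1 + R.deg j) n)
    (T := R.φ₃.restrictScalars ℂ) (R.graded₃.map_vecComponent n)
    (ker_eq_range_restrictScalars R.exact₂)
  have g3 : Module.finrank ℂ ((LinearMap.range (vecComponent R.e n)).map
      (R.φ₃.restrictScalars ℂ)) = Module.finrank ℂ (LinearMap.range (vecComponent R.e n)) :=
    LinearEquiv.finrank_eq (Submodule.equivMapOfInjective (R.φ₃.restrictScalars ℂ) R.injective₃ _).symm
  rw [← e1, ← e2, ← e3, ← g3, ← g2, ← g1]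
  rw [Nat.sub_zero, Nat.cast_zero, sub_zero] at e0
  rw [← e0, ← g0]
  push_cast
  ring

/-! ### Boundedness of the Hilbert function for reduced curves. -/

theorem eq_C_of_pderiv_eq_zero {p : S} (h : ∀ i, pderiv i p = 0) : p = C (constantCoeff p) := by
  ext m
  rw [coeff_C]
  split_ifs with hm
  · rw [← hm, constantCoeff_eq]
  · obtain ⟨i, hi⟩ : ∃ i, m i ≠ 0 := by
      by_contra! hc
      exact hm (Finsupp.ext hc).symm
    have h1 := coeff_pderiv (i := i) p (m - Finsupp.single i 1)
    have h2 : m - Finsupp.single i 1 + Finsupp.single i 1 = m :=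
      tsub_add_cancel_of_le (by simpa using Nat.one_le_iff_ne_zero.mpr hi)
    rw [h i, coeff_zero, h2] at h1
    have h3 : (((m - Finsupp.single i 1 : Fin 3 →₀ ℕ) i : ℕ) : ℂ) + 1 ≠ 0 :=
      Nat.cast_add_one_ne_zero _
    exact (mul_eq_zero.mp h1.symm).resolve_right h3

theorem totalDegree_pderiv_lt {p : S} {i : Fin 3} (h : pderiv i p ≠ 0) :
    (pderiv i p).totalDegree < p.totalDegree := by
  obtain ⟨m, hm, hdeg⟩ := Finset.exists_mem_eq_sup (pderiv i p).support
    (support_nonempty.mpr h) fun s => s.degree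
  have h1 : m + Finsupp.single i 1 ∈ p.support := by
    rw [mem_support_iff] at hm ⊢
    rw [coeff_pderiv] at hm
    exact left_ne_zero_of_mul hm
  have h2 := le_totalDegree h1
  have h3 : (pderiv i p).totalDegree = m.degree := hdeg
  rw [h3]
  have h4 : (m + Finsupp.single i 1).degree = m.degree + 1 := by
    rw [map_add, Finsupp.degree_single]
  have h5 : ((m + Finsupp.single i 1).sum fun _ e => e) = (m + Finsupp.single i 1).degree := rfl
  omega

/-- The partial derivatives of a squarefree form have no common factor. -/
theorem exists_not_dvd_pderiv {f : S} {d : ℕ} (hd : d ≠ 0) (hf : f.IsHomogeneous d)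
    (hsq : Squarefree f) {p : S} (hp : Irreducible p) : ∃ i, ¬ p ∣ pderiv i f := by
  by_contra! h
  have hpf : p ∣ f := by
    have h1 : p ∣ d • f := by
      rw [← hf.sum_X_mul_pderiv]
      exact Finset.dvd_sum fun i _ => (h i).mul_left _
    have h2 : f = C (d : ℂ)⁻¹ * (d • f) := by
      rw [nsmul_eq_mul, ← mul_assoc, ← map_natCast (C : ℂ →+* S) d, ← C_mul,
        inv_mul_cancel₀ (Nat.cast_ne_zero.mpr hd), C_1, one_mul]
    rw [h2]
    exact h1.mul_left _
  obtain ⟨g, rfl⟩ := hpf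
  have hg : ¬ p ∣ g := fun ⟨q, hq⟩ => hp.not_isUnit (hsq p ⟨q, by rw [hq]; ring⟩)
  -- By Leibniz `p` divides `pderiv i p * g`, hence `pderiv i p`, whose total degree would be
  -- smaller if it were nonzero.
  have hz : ∀ i, pderiv i p = 0 := fun i => by
    by_contra hne
    have h1 := h i
    rw [pderiv_mul, dvd_add_left (dvd_mul_right p _)] at h1
    obtain ⟨q, hq⟩ := (hp.prime.dvd_or_dvd h1).resolve_right hg
    have hq0 : q ≠ 0 := by rintro rfl; exact hne (by rw [hq, mul_zero])
    have h2 := totalDegree_pderiv_lt hne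
    rw [hq, totalDegree_mul_of_isDomain hp.ne_zero hq0] at h2
    omega
  have hC := eq_C_of_pderiv_eq_zero hz
  apply hp.not_isUnit
  have h0 : constantCoeff p ≠ 0 := fun h0 => hp.ne_zero (by rw [hC, h0, C_0])
  rw [hC]
  exact (isUnit_iff_ne_zero.mpr h0).map C

/-- Among the linear combinations of forms without common factor there are two which are
relatively prime. -/
theorem exists_isRelPrime_add_C_mul {g a b : S} (hg : g ≠ 0)
    (h : ∀ p, Irreducible p → p ∣ g → p ∣ a → ¬ p ∣ b) : ∃ c : ℂ, IsRelPrime g (a + C c * b) := by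
  classical
  -- Each irreducible factor of `g` excludes at most one `c`: two would make it divide both `b` and
  -- `a`. As `ℂ` is infinite, a good `c` remains.
  let bad : Set ℂ := ⋃ p ∈ (UniqueFactorizationMonoid.factors g).toFinset,
    {c : ℂ | p ∣ a + C c * b}
  have hbad : bad.Finite := by
    refine Set.Finite.biUnion (Finset.finite_toSet _) fun p hp => ?_
    have hp' : p ∈ UniqueFactorizationMonoid.factors g := by simpa using hp
    have hirr := UniqueFactorizationMonoid.irreducible_of_factor p hp'
    have hpg := UniqueFactorizationMonoid.dvd_of_mem_factors hp'
    refine Set.Subsingleton.finite fun c hc c' hc' => ?_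
    by_contra hne
    have hb : p ∣ b := by
      have h1 : p ∣ C (c - c') * b := by
        have := dvd_sub hc hc'
        rwa [show a + C c * b - (a + C c' * b) = C (c - c') * b by rw [C_sub]; ring] at this
      have h2 := h1.mul_left (C (c - c')⁻¹)
      rwa [← mul_assoc, ← C_mul, inv_mul_cancel₀ (sub_ne_zero.mpr hne), C_1, one_mul] at h2
    exact h p hirr hpg ((dvd_add_left (hb.mul_left _)).mp hc) hb
  obtain ⟨c, hc⟩ := hbad.exists_notMem
  refine ⟨c, WfDvdMonoid.isRelPrime_of_no_irreducible_factors (fun h0 => hg h0.1) ?_⟩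
  intro p hp hpg hpc
  obtain ⟨q, hq, hassoc⟩ := UniqueFactorizationMonoid.exists_mem_factors_of_dvd hg hp hpg
  exact hc (Set.mem_biUnion (by simpa using hq) (hassoc.symm.dvd.trans hpc))

theorem exact_of_isRelPrime {g h : S} (hg : g ≠ 0) (hgh : IsRelPrime g h) :
    Function.Exact (Fintype.linearCombination S fun _ : Fin 1 => ![h, -g])
      (Fintype.linearCombination S ![g, h]) := by
  intro v
  simp only [Fintype.linearCombination_apply, Fin.sum_univ_two, Set.mem_range,
    Matrix.cons_val_zero, Matrix.cons_val_one, smul_eq_mul, Fin.sum_univ_one]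
  constructor
  · intro hv
    obtain ⟨c, hc⟩ : g ∣ v 1 :=
      hgh.dvd_of_dvd_mul_right ⟨-v 0, by linear_combination hv⟩
    refine ⟨fun _ => -c, ?_⟩
    have h0 : v 0 = -c * h := mul_left_cancel₀ hg (by rw [hc] at hv; linear_combination hv)
    funext i
    fin_cases i
    · simp [h0]
    · simp [hc, mul_comm]
  · rintro ⟨w, rfl⟩
    simp
    ring

/-- Bézout: `M(f)` is a quotient of `S / (g, h)`, a complete intersection of degree `(d - 1)²`. -/
theorem finrank_milnorComponent_le_of_isRelPrime {f g h : S} {d : ℕ} (hf : f.IsHomogeneous d)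
    (hg : g.IsHomogeneous (d - 1)) (hh : h.IsHomogeneous (d - 1)) (hg0 : g ≠ 0)
    (hgh : IsRelPrime g h) (hgJ : g ∈ jacobianIdeal f) (hhJ : h ∈ jacobianIdeal f) {n : ℕ}
    (hn : 2 * (d - 1) ≤ n) :
    (Module.finrank ℂ (milnorComponent f n) : ℚ) ≤ ((d - 1 : ℕ) : ℚ) ^ 2 := by
  have hrange : LinearMap.range (Fintype.linearCombination S ![g, h]) ≤
      LinearMap.range (gradientMap f) := by
    rw [Fintype.range_linearCombination, Submodule.span_le, range_gradientMap]
    rintro _ ⟨l, rfl⟩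
    revert l
    exact Fin.forall_fin_two.mpr ⟨hgJ, hhJ⟩
  have hT : ∀ l, (![g, h] l).IsHomogeneous (d - 1) := Fin.forall_fin_two.mpr ⟨hg, hh⟩
  have hT' : ∀ v, (Fintype.linearCombination S ![g, h]).restrictScalars ℂ
      (vecComponent (fun _ => d - 1) n v) =
      homogeneousComponent n ((Fintype.linearCombination S ![g, h]).restrictScalars ℂ v) :=
    fun v => by
      rw [LinearMap.restrictScalars_apply, LinearMap.restrictScalars_apply]
      exact homogeneousComponent_linearCombination hT n v
  have hG : ∀ v, (gradientMap f).restrictScalars ℂ (vecComponent (fun _ => d - 1) n v) =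
      homogeneousComponent n ((gradientMap f).restrictScalars ℂ v) := fun v => by
    rw [LinearMap.restrictScalars_apply, LinearMap.restrictScalars_apply, gradientMap]
    exact homogeneousComponent_linearCombination (fun i => hf.pderiv) n v
  have hU : IsGradedMap (fun _ : Fin 1 => 2 * (d - 1)) (fun _ : Fin 2 => d - 1)
      (Fintype.linearCombination S fun _ : Fin 1 => ![h, -g]) := by
    refine isGradedMap_linearCombination fun _ l => Or.inl ⟨by omega, ?_⟩
    rw [show 2 * (d - 1) - (d - 1) = d - 1 by omega]
    revert l
    exact Fin.forall_fin_two.mpr ⟨hh, hg.neg⟩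
  obtain ⟨F1, e1⟩ := finite_finrank_range_vecComponent (fun _ : Fin 3 => d - 1) (n := n)
    fun _ => by omega
  obtain ⟨F2, e2⟩ := finite_finrank_range_vecComponent (fun _ : Fin 2 => d - 1) (n := n)
    fun _ => by omega
  obtain ⟨F3, e3⟩ := finite_finrank_range_vecComponent (fun _ : Fin 1 => 2 * (d - 1)) (n := n)
    fun _ => hn
  have e0 := finrank_homogeneousSubmodule_sub (Nat.zero_le n)
  have g0 := finrank_milnorComponent_add hf n
  have g1 := finrank_map_add_finrank_map (p := vecComponent (fun _ : Fin 1 => 2 * (d - 1)) n)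
    (vecComponent_vecComponent (fun _ : Fin 2 => d - 1) n)
    (T := (Fintype.linearCombination S fun _ : Fin 1 => ![h, -g]).restrictScalars ℂ)
    (hU.map_vecComponent n) (ker_eq_range_restrictScalars (exact_of_isRelPrime hg0 hgh))
  -- An upper bound on the syzygies of `(g, h)` suffices, so injectivity of the Koszul map is not
  -- needed.
  have g2 := Submodule.finrank_map_le
    ((Fintype.linearCombination S fun _ : Fin 1 => ![h, -g]).restrictScalars ℂ)
    (LinearMap.range (vecComponent (fun _ : Fin 1 => 2 * (d - 1)) n))
  have g3 : Module.finrank ℂ ((LinearMap.range (vecComponent (fun _ : Fin 2 => d - 1) n)).map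
      ((Fintype.linearCombination S ![g, h]).restrictScalars ℂ)) ≤
      Module.finrank ℂ ((LinearMap.range (vecComponent (fun _ : Fin 3 => d - 1) n)).map
        ((gradientMap f).restrictScalars ℂ)) := by
    apply Submodule.finrank_mono
    rw [map_range_eq_inf (homogeneousComponent_homogeneousComponent n) hT',
      map_range_eq_inf (homogeneousComponent_homogeneousComponent n) hG]
    exact inf_le_inf le_rfl fun x hx => hrange hx
  rw [Nat.sub_zero, Nat.cast_zero, sub_zero] at e0
  simp only [Finset.sum_const, Finset.card_univ, Fintype.card_fin, nsmul_eq_mul] at e2 e3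
  rw [← Nat.cast_le (α := ℚ)] at g2 g3
  rw [← Nat.cast_inj (R := ℚ), Nat.cast_add] at g0 g1
  push_cast at e2 e3
  linarith

theorem exists_isRelPrime_pderiv {f : S} {d : ℕ} (hd : d ≠ 0) (hf : f.IsHomogeneous d)
    (hsq : Squarefree f) {i : Fin 3} (hi : pderiv i f ≠ 0) :
    ∃ c : ℂ, IsRelPrime (pderiv i f) (pderiv (i + 1) f + C c * pderiv (i + 2) f) := by
  refine exists_isRelPrime_add_C_mul hi fun p hp h1 h2 h3 => ?_
  obtain ⟨j, hj⟩ := exists_not_dvd_pderiv hd hf hsq hp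
  have hcases : ∀ i j : Fin 3, j = i ∨ j = i + 1 ∨ j = i + 2 := by decide
  rcases hcases i j with rfl | rfl | rfl
  · exact hj h1
  · exact hj h2
  · exact hj h3

/-- The Hilbert function of the Milnor algebra of a reduced curve is bounded. -/
theorem exists_finrank_milnorComponent_le {f : S} {d : ℕ} (hd : d ≠ 0) (hf : f.IsHomogeneous d)
    (hsq : Squarefree f) :
    ∃ B : ℚ, ∀ᶠ n : ℕ in Filter.atTop, (Module.finrank ℂ (milnorComponent f n) : ℚ) ≤ B := by
  obtain ⟨i, hi⟩ := pderiv_ne_zero_of_isHomogeneous hd hf hsq.ne_zero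
  obtain ⟨c, hc⟩ := exists_isRelPrime_pderiv hd hf hsq hi
  have hJ : ∀ i, pderiv i f ∈ jacobianIdeal f := fun i => Ideal.subset_span ⟨i, rfl⟩
  have hh : pderiv (i + 1) f + C c * pderiv (i + 2) f ∈ jacobianIdeal f :=
    add_mem (hJ _) (Ideal.mul_mem_left _ _ (hJ _))
  have hh' : (pderiv (i + 1) f + C c * pderiv (i + 2) f).IsHomogeneous (d - 1) :=
    hf.pderiv.add (hf.pderiv.C_mul c)
  refine ⟨((d - 1 : ℕ) : ℚ) ^ 2, ?_⟩
  filter_upwards [Filter.eventually_ge_atTop (2 * (d - 1))] with n hn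
  exact finrank_milnorComponent_le_of_isRelPrime hf hf.pderiv hh' hi hc (hJ i) hh hn

/-! ### Degrees of the second syzygies. -/

theorem eq_zero_of_eventually_bounded {A B M : ℚ}
    (h : ∀ᶠ n : ℕ in Filter.atTop, 0 ≤ A * n + B ∧ A * n + B ≤ M) : A = 0 := by
  rcases lt_trichotomy A 0 with hA | hA | hA
  · obtain ⟨n, hn, h1, _⟩ :=
      ((tendsto_natCast_atTop_atTop.eventually_gt_atTop (B / -A)).and h).exists
    rw [div_lt_iff₀ (by linarith)] at hn
    linarith
  · exact hA
  · obtain ⟨n, hn, _, h2⟩ :=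
      ((tendsto_natCast_atTop_atTop.eventually_gt_atTop ((M - B) / A)).and h).exists
    rw [div_lt_iff₀ hA] at hn
    linarith

/-- By injectivity a column of `φ₃` has a nonzero entry, and by minimality that entry is not
constant. -/
theorem MinimalResolution.lt_e {f : S} {d r : ℕ} (R : MinimalResolution f d)
    (hdeg : ∀ j, R.deg j = r) (i : Fin R.k) : d - 1 + r < R.e i := by
  have hne : R.φ₃ (Pi.single i 1) ≠ 0 := fun h => by
    have := R.injective₃ (h.trans (map_zero _).symm)
    simp at this
  obtain ⟨j, hj⟩ := Function.ne_iff.mp hne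
  rcases R.graded₃ i j with ⟨h, h'⟩ | h
  · simp only [hdeg] at h h'
    refine lt_of_le_of_ne h fun heq => hj ?_
    rw [← heq, Nat.sub_self, ← totalDegree_zero_iff_isHomogeneous,
      totalDegree_eq_zero_iff_eq_C] at h'
    have h0 := R.minimal₃ i j
    rw [constantCoeff_eq] at h0
    rw [h', h0, C_0, Pi.zero_apply]
  · exact absurd h hj

/-- The Hilbert function of the Milnor algebra when all first syzygies have degree `r`. -/
theorem MinimalResolution.finrank_milnorComponent_of_deg_eq {f : S} {d r : ℕ}
    (R : MinimalResolution f d) (hd : 1 ≤ d) (hf : f.IsHomogeneous d)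
    (hdeg : ∀ j, R.deg j = r) : ∀ᶠ n : ℕ in Filter.atTop,
      (Module.finrank ℂ (milnorComponent f n) : ℚ) =
        (3 * ((d : ℚ) - 1) - (R.k + 2) * (d - 1 + r) + ∑ i, (R.e i : ℚ)) * n +
        ((3 * ((d : ℚ) - 1) - (R.k + 2) * (d - 1 + r) + ∑ i, (R.e i : ℚ)) * 3 / 2 +
        (-3 * ((d : ℚ) - 1) ^ 2 + (R.k + 2) * (d - 1 + r) ^ 2 - ∑ i, (R.e i : ℚ) ^ 2) / 2) := by
  filter_upwards [R.finrank_milnorComponent hf] with n hn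
  have hsum : ∑ i, ((n : ℚ) - R.e i + 1) * (n - R.e i + 2) / 2 =
      R.k * ((n + 1) * (n + 2) / 2) - (n + 3 / 2) * ∑ i, (R.e i : ℚ)
        + (∑ i, (R.e i : ℚ) ^ 2) / 2 := by
    rw [Finset.mul_sum, Finset.sum_div, show (R.k : ℚ) * ((n + 1) * (n + 2) / 2) =
      ∑ _i : Fin R.k, (((n : ℚ) + 1) * (n + 2) / 2) by simp, ← Finset.sum_sub_distrib,
      ← Finset.sum_add_distrib]
    exact Finset.sum_congr rfl fun i _ => by ring
  rw [hn, hsum]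
  simp only [hdeg, Finset.sum_const, Finset.card_univ, Fintype.card_fin, nsmul_eq_mul]
  push_cast [Nat.cast_sub hd]
  ring

/-- The left side is the slope of the Hilbert polynomial, so boundedness, and thus reducedness,
makes it vanish. -/
theorem sum_e_eq {f : S} {d r : ℕ} (R : MinimalResolution f d) (hd : 1 ≤ d)
    (hf : f.IsHomogeneous d) (hsq : Squarefree f) (hdeg : ∀ j, R.deg j = r) :
    3 * ((d : ℚ) - 1) - (R.k + 2) * (d - 1 + r) + ∑ i, (R.e i : ℚ) = 0 := by
  obtain ⟨M, hM⟩ := exists_finrank_milnorComponent_le (by omega) hf hsq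
  apply eq_zero_of_eventually_bounded
  filter_upwards [R.finrank_milnorComponent_of_deg_eq hd hf hdeg, hM] with n h1 h2
  exact ⟨(Nat.cast_nonneg _).trans_eq h1, h1.symm.trans_le h2⟩

/-- A monotone family of natural numbers with sum `1` is `0, …, 0, 1`. -/
theorem eq_ite_of_monotone_of_sum_eq_one {k : ℕ} {t : Fin k → ℕ} (ht : Monotone t)
    (hsum : ∑ i, t i = 1) (j : Fin k) : t j = if (j : ℕ) + 1 = k then 1 else 0 := by
  obtain _ | k := k
  · exact j.elim0
  rw [Fin.sum_univ_castSucc] at hsum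
  have hlast : t (Fin.last k) = 1 := by
    by_contra hne
    have h0 : t (Fin.last k) = 0 := by omega
    have : ∑ i : Fin k, t i.castSucc = 0 :=
      Finset.sum_eq_zero fun i _ => Nat.le_zero.mp (h0 ▸ ht (Fin.le_last _))
    omega
  have hzero : ∑ i : Fin k, t i.castSucc = 0 := by omega
  rw [Finset.sum_eq_zero_iff] at hzero
  induction j using Fin.lastCases with
  | last => simp [hlast]
  | cast i => rw [hzero i (Finset.mem_univ i), if_neg]; simp [i.2.ne]

/-- The degrees of the second syzygies when `Δm = 1`. -/
theorem MinimalResolution.e_eq {f : S} {d r : ℕ} (R : MinimalResolution f d) (hd : 1 ≤ d)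
    (hf : f.IsHomogeneous d) (hsq : Squarefree f) (hdeg : ∀ j, R.deg j = r)
    (hk : R.k + d = 2 * r) (j : Fin R.k) :
    R.e j = d + r + if (j : ℕ) + 1 = R.k then 1 else 0 := by
  have hle : ∀ i, d + r ≤ R.e i := fun i => by have := R.lt_e hdeg i; omega
  have hmono : Monotone fun i => R.e i - (d + r) := fun i i' h =>
    Nat.sub_le_sub_right (R.e_mono h) _
  have hsum : ∑ i, (R.e i - (d + r)) = 1 := by
    have h := sum_e_eq R hd hf hsq hdeg
    have h1 : ∑ i, (R.e i : ℚ) = (∑ i, (R.e i - (d + r)) : ℕ) + R.k * (d + r) := by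
      push_cast [Nat.cast_sub (hle _)]
      simp only [Finset.sum_sub_distrib, Finset.sum_const, Finset.card_univ, Fintype.card_fin,
        nsmul_eq_mul]
      ring
    have h2 : (R.k : ℚ) + d = 2 * r := by exact_mod_cast hk
    rw [h1] at h
    have h3 : ((∑ i, (R.e i - (d + r)) : ℕ) : ℚ) = 1 := by linear_combination h - h2
    exact_mod_cast h3
  have := eq_ite_of_monotone_of_sum_eq_one hmono hsum j
  have := hle j
  omega

end PlaneCurve

/-! ### The main theorem. -/

theorem mainTheorem2 (f : PlaneCurve.S) (d r m : ℕ) (hC : PlaneCurve.IsCurveOfType f d r m)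
    (hm : 3 < m) (hΔ : (2 * r - d + 3 - m : ℤ) = 1) :
    Nonempty (PlaneCurve.MinimalResolution f d) ∧
    (∀ R : PlaneCurve.MinimalResolution f d,
      R.k + 2 = m ∧ (∀ j, R.deg j = r) ∧
      (∀ j : Fin R.k, (j : ℕ) + 1 = R.k → R.ε j = 2) ∧
      (∀ j : Fin R.k, (j : ℕ) + 1 < R.k → R.ε j = 1)) ∧
    ∃ τ : ℕ, PlaneCurve.IsTotalTjurinaNumber f τ ∧
      (τ : ℚ) = (d : ℚ) * (d - 1) / 2 - 1 + r * (d - r - 2) := by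
  obtain ⟨ρ, hρ⟩ := hC.generators
  have hd := hC.three_le
  have hf := hC.homogeneous
  have hsq := hC.reduced
  have hne : Nonempty (PlaneCurve.MinimalResolution f d) :=
    PlaneCurve.nonempty_minimalResolution hd hf hsq.ne_zero (by omega) hρ
  refine ⟨hne, fun R => ?_, ?_⟩
  · obtain ⟨hk, hdeg⟩ := R.card_and_deg hρ
    have he := R.e_eq (by omega) hf hsq hdeg (by omega)
    refine ⟨hk, hdeg, fun j hj => ?_, fun j hj => ?_⟩
    · rw [PlaneCurve.MinimalResolution.ε, he j, hdeg, if_pos hj]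
      push_cast
      ring
    · rw [PlaneCurve.MinimalResolution.ε, he j, hdeg, if_neg hj.ne]
      push_cast
      ring
  · obtain ⟨R⟩ := hne
    obtain ⟨hk, hdeg⟩ := R.card_and_deg hρ
    have hkd : R.k + d = 2 * r := by omega
    have he := R.e_eq (by omega) hf hsq hdeg hkd
    have h0 := PlaneCurve.sum_e_eq R (by omega) hf hsq hdeg
    have hkd' : (R.k : ℚ) = 2 * r - d := by
      rw [eq_sub_iff_add_eq]; exact_mod_cast hkd
    -- Each `e_i` is a root of `(t - (d + r)) (t - (d + r + 1))`, so the sum of squares is linear in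
    -- the sum already known.
    have hsq_sum : ∑ i, (R.e i : ℚ) ^ 2 =
        (2 * (d + r) + 1) * ∑ i, (R.e i : ℚ) - R.k * (d + r) * (d + r + 1) := by
      rw [Finset.mul_sum, show (R.k : ℚ) * (d + r) * (d + r + 1) =
        ∑ _i : Fin R.k, ((d : ℚ) + r) * (d + r + 1) by simp [mul_assoc],
        ← Finset.sum_sub_distrib]
      refine Finset.sum_congr rfl fun i _ => ?_
      rw [he i]
      split_ifs <;> push_cast <;> ring
    have hH : ∀ᶠ n : ℕ in Filter.atTop,
        (Module.finrank ℂ (PlaneCurve.milnorComponent f n) : ℚ) =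
          (d : ℚ) * (d - 1) / 2 - 1 + r * (d - r - 2) := by
      filter_upwards [R.finrank_milnorComponent_of_deg_eq (by omega) hf hdeg] with n hn
      -- The slope also occurs inside the constant term, so `h0` removes it from both places.
      rw [hn, hsq_sum, h0]
      have h1 : ∑ i, (R.e i : ℚ) = (R.k + 2) * (d - 1 + r) - 3 * ((d : ℚ) - 1) := by
        linear_combination h0
      rw [h1, hkd']
      ring
    obtain ⟨n, hn⟩ := hH.exists
    refine ⟨_, ?_, hn⟩
    filter_upwards [hH] with n' hn'
    exact_mod_cast hn'.trans hn.symm
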